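/- Let $T$ be an ergodic automorphism (an invertible, bimeasurable, measure-preserving ergodic transformation) of a non-atomic Lebesgue probability space $(\Omega,\mathcal{S},\mu)$, that is, a probability space without atoms which is isomorphic modulo null sets, after completion, to a Borel probability measure on $\mathbb{R}$. Let $X$ be a Polish space (a separable completely metrizable topological space), let $\eta$ be a Borel probability measure on $X$, and let $c\colon X\times X\to[0,\infty)$ be a cost function, i.e. an upper semicontinuous function with $c(x,x)=0$ for all $x\in X$. Then, for every $\varepsilon>0$, there exists a measurable function $f\colon\Omega\to X$ such that $f_*\mu=\eta$ and $$\int_\Omega c\big(f(\omega),f(T\omega)\big)\,d\mu(\omega)<\varepsilon .$$ -/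

import Mathlib

open MeasureTheory

/-- `φ` and `ψ` are mutually inverse isomorphisms modulo null sets between the measure spaces
`(α, μ)` and `(β, ν)`, both equipped with their completed σ-algebras: each map pulls back
null-measurable sets to null-measurable sets and preserves the measure, and the two composites are
almost everywhere the identity. (They then restrict to inverse bijections between the conull sets
`{x | ψ (φ x) = x}` and `{y | φ (ψ y) = y}`.) -/
structure IsIsoModZero {α β : Type*} [MeasurableSpace α] [MeasurableSpace β]
    (μ : Measure α) (ν : Measure β) (φ : α → β) (ψ : β → α) : Prop where
  nullMeasurableSet_preimage : ∀ s, NullMeasurableSet s ν → NullMeasurableSet (φ ⁻¹' s) μ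
  nullMeasurableSet_preimage_inv : ∀ s, NullMeasurableSet s μ → NullMeasurableSet (ψ ⁻¹' s) ν
  measure_preimage : ∀ s, NullMeasurableSet s ν → μ (φ ⁻¹' s) = ν s
  measure_preimage_inv : ∀ s, NullMeasurableSet s μ → ν (ψ ⁻¹' s) = μ s
  left_inv : ∀ᵐ x ∂μ, ψ (φ x) = x
  right_inv : ∀ᵐ y ∂ν, φ (ψ y) = y

/-- `(Ω, μ)` is a Lebesgue (probability) space: modulo null sets, it is isomorphic to a Borel
probability measure on the real line. The σ-algebra of `Ω` is compared after completion, so that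
both usual conventions (complete σ-algebra, or standard Borel σ-algebra) are covered. -/
def IsLebesgueSpace {Ω : Type*} [MeasurableSpace Ω] (μ : Measure Ω) : Prop :=
  ∃ ν : Measure ℝ, IsProbabilityMeasure ν ∧ ∃ (φ : Ω → ℝ) (ψ : ℝ → Ω), IsIsoModZero μ ν φ ψ

/-- A cost function: a nonnegative upper semicontinuous function on `X × X` that vanishes on the
diagonal. -/
structure IsCostFunction {X : Type*} [TopologicalSpace X] (c : X × X → ℝ) : Prop where
  nonneg : ∀ p, 0 ≤ c p
  upperSemicontinuous : UpperSemicontinuous c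
  diag : ∀ x, c (x, x) = 0

open ProbabilityTheory Filter Topology unitInterval

/-! Off a null set, cut `X` into countably many cells inside which the cost is at most `ε / 2`, with
the cost between cells `i` and `j` at most `C (max i j)`. It then suffices to label `Ω` by cells,
with the law prescribed by `η`, so that label changes along `T` with larger label `k` have
probability at most `δ k`, where `∑ C k * δ k < ε / 2`. Such a labelling lifts to `f` by
transporting each label class onto its cell. The labelling is
`Ergodic.exists_measurable_nat_map_eq`. Ergodicity gives atomless observables `g k` that `T` changes
only on a set of measure at most `δ k`. The label of `ω` is the largest `k` with `g k ω < t k`, so a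
change with larger label `k` forces `g k` itself to change. The thresholds `t k` giving the exact
law come from the intermediate value theorem and compactness. -/

/-! ### Atomless observables and transport of measures. -/

/-- A nonatomic Lebesgue space carries a measurable real function whose law has no atoms. -/
theorem IsLebesgueSpace.exists_measurable_preimage_singleton {Ω : Type*} [MeasurableSpace Ω]
    {μ : Measure Ω} [NullSingletonClass μ] (hμ : IsLebesgueSpace μ) :
    ∃ u : Ω → ℝ, Measurable u ∧ ∀ a, μ (u ⁻¹' {a}) = 0 := by
  obtain ⟨ν, -, φ, ψ, h⟩ := hμ
  have hφ : AEMeasurable φ μ :=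
    NullMeasurable.aemeasurable fun s hs => h.nullMeasurableSet_preimage s hs.nullMeasurableSet
  refine ⟨hφ.mk φ, hφ.measurable_mk, fun a => ?_⟩
  refine measure_mono_null_ae ?_ (measure_singleton (μ := μ) (ψ a))
  filter_upwards [hφ.ae_eq_mk, h.left_inv] with x hx hx' hxa
  have hxa' : hφ.mk φ x = a := hxa
  change x = ψ a
  rw [← hxa', ← hx, hx']

/-- The probability integral transform: an atomless law is carried to the uniform distribution by
its distribution function. -/
theorem map_cdf_eq_volume (ν : Measure ℝ) [IsProbabilityMeasure ν] [NullSingletonClass ν] :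
    ν.map (fun x => (⟨cdf ν x, cdf_nonneg ν x, cdf_le_one ν x⟩ : I)) = volume := by
  have hm : Measurable (fun x => (⟨cdf ν x, cdf_nonneg ν x, cdf_le_one ν x⟩ : I)) :=
    (monotone_cdf ν).measurable.subtype_mk
  have hcont : Continuous (cdf ν) := by
    rw [continuous_iff_continuousAt]
    intro x
    rw [(monotone_cdf ν).continuousAt_iff_leftLim_eq_rightLim, (cdf ν).rightLim_eq]
    have h0 : (cdf ν).measure {x} = 0 := by rw [measure_cdf, measure_singleton]
    rw [StieltjesFunction.measure_singleton, ENNReal.ofReal_eq_zero] at h0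
    exact le_antisymm ((monotone_cdf ν).leftLim_le le_rfl) (by linarith)
  have hsurj : ∀ s : ℝ, 0 < s → s < 1 → ∃ x, cdf ν x = s := fun s h0 h1 =>
    mem_range_of_exists_le_of_exists_ge hcont
      (((tendsto_cdf_atBot ν).eventually_le_const h0).exists)
      (((tendsto_cdf_atTop ν).eventually_const_le h1).exists)
  have : IsProbabilityMeasure (ν.map
      (fun x => (⟨cdf ν x, cdf_nonneg ν x, cdf_le_one ν x⟩ : I))) :=
    Measure.isProbabilityMeasure_map hm.aemeasurable
  refine Measure.ext_of_Iic _ _ fun t => ?_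
  rw [Measure.map_apply hm measurableSet_Iic, unitInterval.volume_Iic]
  change ν {x | (⟨cdf ν x, cdf_nonneg ν x, cdf_le_one ν x⟩ : I) ≤ t} = _
  simp only [← Subtype.coe_le_coe]
  apply le_antisymm
  -- The distribution function may be flat at level `t`, so a point where it equals `t` need not
  -- bound the sublevel set; a point at a level `b > t` does.
  · refine le_of_forall_gt_imp_ge_of_dense fun b hb => ?_
    by_cases hb1 : 1 ≤ b
    · exact prob_le_one.trans hb1
    push Not at hb1
    have hbt : b ≠ ⊤ := (hb1.trans ENNReal.one_lt_top).ne
    have hb' : t.1 < b.toReal := (ENNReal.ofReal_lt_iff_lt_toReal t.2.1 hbt).1 hb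
    obtain ⟨x, hx⟩ := hsurj b.toReal (t.2.1.trans_lt hb')
      (by rw [← ENNReal.toReal_one]; exact (ENNReal.toReal_lt_toReal hbt ENNReal.one_ne_top).2 hb1)
    calc ν {y | cdf ν y ≤ t} ≤ ν (Set.Iic x) := by
          refine measure_mono fun y hy => ?_
          by_contra hxy
          have h1 : cdf ν x ≤ cdf ν y := monotone_cdf ν (not_le.1 hxy).le
          have h2 : cdf ν y ≤ t := hy
          linarith
      _ = b := by rw [← ofReal_cdf, hx, ENNReal.ofReal_toReal hbt]
  · rcases eq_or_lt_of_le t.2.1 with h0 | h0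
    · rw [← h0]; simp
    rcases eq_or_lt_of_le t.2.2 with h1 | h1
    · have : {x | cdf ν x ≤ t.1} = Set.univ := by
        ext x; simp [h1, cdf_le_one]
      rw [this]; simp [h1]
    obtain ⟨x, hx⟩ := hsurj t h0 h1
    calc ENNReal.ofReal t = ν (Set.Iic x) := by rw [← ofReal_cdf, hx]
      _ ≤ _ := measure_mono fun y hy => (monotone_cdf ν hy).trans hx.le

/-- A finite measure with an atomless real observable can be mapped onto every measure of the same
mass on a standard Borel space. -/
theorem exists_measurable_map_eq_of_preimage_singleton {Ω X : Type*} [MeasurableSpace Ω]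
    [MeasurableSpace X] [StandardBorelSpace X] [Nonempty X] (μ : Measure Ω) [IsFiniteMeasure μ]
    (η : Measure X) (hmass : μ Set.univ = η Set.univ) {u : Ω → ℝ} (hu : Measurable u)
    (hu0 : ∀ a, μ (u ⁻¹' {a}) = 0) :
    ∃ f : Ω → X, Measurable f ∧ μ.map f = η := by
  by_cases h0 : μ Set.univ = 0
  · refine ⟨fun _ => Classical.arbitrary X, measurable_const, ?_⟩
    have hη : η = 0 := Measure.measure_univ_eq_zero.1 (hmass.symm.trans h0)
    rw [Measure.measure_univ_eq_zero.1 h0, hη, Measure.map_zero]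
  have hη0 : η Set.univ ≠ 0 := hmass ▸ h0
  have htop : μ Set.univ ≠ ⊤ := measure_ne_top _ _
  have hηtop : η Set.univ ≠ ⊤ := hmass ▸ htop
  have : IsFiniteMeasure η := ⟨hηtop.lt_top⟩
  have : NeZero η := ⟨fun h => hη0 (by simp [h])⟩
  have : NeZero μ := ⟨fun h => h0 (by simp [h])⟩
  set m := (μ Set.univ)⁻¹ with hm
  set ν := (m • μ).map u with hν
  have : IsProbabilityMeasure ν := Measure.isProbabilityMeasure_map hu.aemeasurable
  have : NullSingletonClass ν := ⟨fun x => by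
    rw [hν, Measure.map_apply hu (measurableSet_singleton x)]
    simp [hu0]⟩
  have : IsProbabilityMeasure (m • η) := by rw [hm, hmass]; infer_instance
  obtain ⟨k, hk, hkη⟩ := Measure.exists_measurable_map_eq (m • η)
  have hF : Measurable (fun x => (⟨cdf ν x, cdf_nonneg ν x, cdf_le_one ν x⟩ : I)) :=
    (monotone_cdf ν).measurable.subtype_mk
  refine ⟨_, hk.comp (hF.comp hu), ?_⟩
  have h1 : (m • μ).map (k ∘ (fun x => (⟨cdf ν x, cdf_nonneg ν x, cdf_le_one ν x⟩ : I)) ∘ u)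
      = m • η := by
    rw [← Measure.map_map hk (hF.comp hu), ← Measure.map_map hF hu, map_cdf_eq_volume, hkη]
  rw [Measure.map_smul] at h1
  have h2 := congrArg (fun ρ => (μ Set.univ) • ρ) h1
  simpa only [smul_smul, hm, ENNReal.mul_inv_cancel h0 htop, one_smul] using h2

/-! ### Almost invariant observables from first visits. -/

/-- Observables with atomless law that are almost invariant: take the value of `u` at the first
visit to a small set. -/
theorem Ergodic.exists_measurable_measure_ne_le {Ω : Type*} [MeasurableSpace Ω]
    {μ : Measure Ω} [IsProbabilityMeasure μ] {T : Ω → Ω} (hT : Ergodic T μ) {u : Ω → ℝ}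
    (hu : Measurable u) (hu0 : ∀ a, μ (u ⁻¹' {a}) = 0) {δ : ENNReal} (hδ : δ ≠ 0) :
    ∃ g : Ω → ℝ, Measurable g ∧ (∀ a, μ (g ⁻¹' {a}) = 0) ∧ μ {ω | g (T ω) ≠ g ω} ≤ δ := by
  classical
  obtain ⟨B, hB, hB0, hBδ⟩ : ∃ B, MeasurableSet B ∧ μ B ≠ 0 ∧ μ B ≤ δ := by
    obtain ⟨v, hv, hvμ⟩ := exists_measurable_map_eq_of_preimage_singleton μ (volume : Measure I)
      (by simp) hu hu0
    obtain ⟨d, hd0, hd⟩ := ENNReal.lt_iff_exists_nnreal_btwn.1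
      (lt_min (pos_iff_ne_zero.2 hδ) one_pos)
    have hd1 : (d : ℝ) ≤ 1 := by exact_mod_cast (hd.le.trans (min_le_right _ _))
    have hμB : μ (v ⁻¹' Set.Iic ⟨d, d.2, hd1⟩) = d := by
      rw [← Measure.map_apply hv measurableSet_Iic, hvμ, unitInterval.volume_Iic]
      simp
    exact ⟨_, hv measurableSet_Iic, by rw [hμB]; exact hd0.ne', by
      rw [hμB]; exact hd.le.trans (min_le_left _ _)⟩
  have hTm : Measurable T := hT.measurable
  have hTn (n : ℕ) : Measurable T^[n] := hTm.iterate n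
  set W : Set Ω := {ω | ∃ n, T^[n] ω ∈ B} with hW
  have hWm : MeasurableSet W := by
    rw [hW, Set.ofPred_exists]
    exact MeasurableSet.iUnion fun n => hTn n hB
  have hW1 : ∀ᵐ ω ∂μ, ω ∈ W := by
    have hsub : T ⁻¹' W ⊆ W := fun ω ⟨n, hn⟩ => ⟨n + 1, hn⟩
    rcases hT.ae_empty_or_univ_of_preimage_ae_le hWm.nullMeasurableSet
      (Eventually.of_forall hsub) with h | h
    · exact absurd (measure_mono_null (fun ω hω => ⟨0, hω⟩ : B ⊆ W) (ae_eq_empty.1 h)) hB0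
    · exact eventuallyEq_univ.1 h
  -- The second alternative gives the visit time the value 0 on the null set of points that never
  -- reach `B`.
  let p : Ω → ℕ → Prop := fun ω n => T^[n] ω ∈ B ∨ ω ∉ W
  have hp : ∀ ω, ∃ n, p ω n := fun ω => by
    by_cases h : ω ∈ W
    · exact h.imp fun n hn => Or.inl hn
    · exact ⟨0, Or.inr h⟩
  have hτ : Measurable fun ω => Nat.find (hp ω) :=
    measurable_find hp fun n => (hTn n hB).union hWm.compl
  refine ⟨fun ω => u (T^[Nat.find (hp ω)] ω), ?_, fun a => ?_, ?_⟩
  · have : Measurable fun x : Ω × ℕ => u (T^[x.2] x.1) :=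
      measurable_from_prod_countable_left fun n => hu.comp (hTn n)
    exact this.comp (measurable_id.prodMk hτ)
  · refine measure_mono_null (t := ⋃ n, T^[n] ⁻¹' (u ⁻¹' {a}))
      (fun ω hω => Set.mem_iUnion.2 ⟨_, hω⟩) (measure_iUnion_null fun n => ?_)
    rw [(hT.toMeasurePreserving.iterate n).measure_preimage
      (hu (measurableSet_singleton a)).nullMeasurableSet, hu0]
  · refine le_trans (measure_mono_ae ?_) hBδ
    filter_upwards [hW1, hT.quasiMeasurePreserving.ae hW1] with ω hω hTω hne
    by_contra hωB
    refine hne ?_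
    -- Outside `B`, the orbits of `ω` and `T ω` first meet `B` at the same point, so the observable
    -- can change only on `B`.
    have h1 : Nat.find (hp ω) = Nat.find (hp (T ω)) + 1 := by
      rw [Nat.find_eq_iff]
      refine ⟨?_, ?_⟩
      · rcases Nat.find_spec (hp (T ω)) with h | h
        · exact Or.inl h
        · exact absurd hTω h
      · rintro (_ | n) hn (h | h)
        · exact hωB h
        · exact h hω
        · exact Nat.find_min (hp (T ω)) (Nat.lt_of_succ_lt_succ hn) (Or.inl h)
        · exact h hω
    change u (T^[Nat.find (hp (T ω))] (T ω)) = u (T^[Nat.find (hp ω)] ω)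
    rw [h1, Function.iterate_succ_apply]

/-! ### Thresholds with prescribed tail measures. -/

/-- The points lying in one of the sublevel sets `{g m < t m}`, `n ≤ m < N`. -/
def sublevelUnion {Ω : Type*} (g : ℕ → Ω → ℝ) (t : ℕ → ℝ) (n N : ℕ) : Set Ω :=
  {ω | ∃ m, n ≤ m ∧ m < N ∧ g m ω < t m}

theorem measurableSet_sublevelUnion {Ω : Type*} [MeasurableSpace Ω] {g : ℕ → Ω → ℝ}
    (hg : ∀ m, Measurable (g m)) (t : ℕ → ℝ) (n N : ℕ) :
    MeasurableSet (sublevelUnion g t n N) := by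
  have : sublevelUnion g t n N = ⋃ m, ⋃ (_ : n ≤ m), ⋃ (_ : m < N), g m ⁻¹' Set.Iio (t m) := by
    ext ω; simp [sublevelUnion, and_left_comm]
  rw [this]
  exact .iUnion fun m => .iUnion fun _ => .iUnion fun _ => hg m measurableSet_Iio

theorem sublevelUnion_subset_union {Ω : Type*} (g : ℕ → Ω → ℝ) (t : ℕ → ℝ) (n M N : ℕ) :
    sublevelUnion g t n N ⊆ sublevelUnion g t n M ∪ sublevelUnion g t M N := by
  rintro ω ⟨m, h1, h2, h3⟩
  rcases lt_or_ge m M with h | h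
  · exact Or.inl ⟨m, h1, h, h3⟩
  · exact Or.inr ⟨m, h, h2, h3⟩

theorem sublevelUnion_mono {Ω : Type*} (g : ℕ → Ω → ℝ) (t : ℕ → ℝ) (n : ℕ) :
    Monotone (sublevelUnion g t n) :=
  fun _ _ h _ ⟨m, h1, h2, h3⟩ => ⟨m, h1, h2.trans_le h, h3⟩

/-- Almost every `ω` avoids all the equalities `g m ω = t m`; for such `ω` membership depends on
finitely many strict inequalities, which persist for thresholds near `t`. -/
theorem continuous_measureReal_sublevelUnion {Ω : Type*} [MeasurableSpace Ω] (μ : Measure Ω)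
    [IsFiniteMeasure μ] {g : ℕ → Ω → ℝ} (hg : ∀ m, Measurable (g m))
    (hg0 : ∀ m a, μ (g m ⁻¹' {a}) = 0) (n N : ℕ) :
    Continuous fun t : ℕ → ℝ => μ.real (sublevelUnion g t n N) := by
  rw [continuous_iff_continuousAt]
  intro t
  refine (ENNReal.tendsto_toReal (measure_ne_top _ _)).comp ?_
  refine tendsto_measure_of_ae_tendsto_indicator_of_isFiniteMeasure (𝓝 t)
    (measurableSet_sublevelUnion hg t n N) (fun s => measurableSet_sublevelUnion hg s n N) ?_
  have hae : ∀ᵐ ω ∂μ, ∀ m, g m ω ≠ t m := ae_all_iff.2 fun m => by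
    have := hg0 m (t m)
    rwa [measure_eq_zero_iff_ae_notMem] at this
  filter_upwards [hae] with ω hω
  have hm : ∀ m, ∀ᶠ s : ℕ → ℝ in 𝓝 t, (g m ω < s m ↔ g m ω < t m) := fun m => by
    have hc : Tendsto (fun s : ℕ → ℝ => s m) (𝓝 t) (𝓝 (t m)) := (continuous_apply m).tendsto t
    rcases lt_or_gt_of_ne (hω m) with h | h
    · filter_upwards [hc.eventually_const_lt h] with s hs
      exact ⟨fun _ => h, fun _ => hs⟩
    · filter_upwards [hc.eventually_lt_const h] with s hs
      exact ⟨fun h' => absurd h' hs.le.not_gt, fun h' => absurd h' h.le.not_gt⟩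
  have hall : ∀ᶠ s : ℕ → ℝ in 𝓝 t, ∀ m ∈ Finset.range N, (g m ω < s m ↔ g m ω < t m) :=
    (Filter.eventually_all_finset _).2 fun m _ => hm m
  filter_upwards [hall] with s hs
  refine exists_congr fun m => and_congr_right fun _ => and_congr_right fun h => ?_
  exact hs m (Finset.mem_range.2 h)

/-- Finite version of `exists_measureReal_iUnion_sublevelUnion_eq`. -/
theorem exists_measureReal_sublevelUnion_eq {Ω : Type*} [MeasurableSpace Ω] (μ : Measure Ω)
    [IsProbabilityMeasure μ] (N : ℕ) : ∀ {g : ℕ → Ω → ℝ} (_ : ∀ m, Measurable (g m))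
    (_ : ∀ m a, μ (g m ⁻¹' {a}) = 0) (_ : ∀ m ω, g m ω ∈ Set.Ioo 0 1)
    {q : ℕ → ℝ} (_ : Antitone q) (_ : ∀ n, q n ∈ Set.Icc 0 1),
    ∃ t : ℕ → I, ∀ n ≤ N, μ.real (sublevelUnion g (fun m => t m) n N) = q n - q N := by
  induction N with
  | zero =>
    intro g _ _ _ q _ _
    refine ⟨fun _ => 0, fun n hn => ?_⟩
    obtain rfl : n = 0 := by omega
    simp [sublevelUnion]
  | succ N ih =>
    intro g hg hg0 hg1 q hq hq1
    obtain ⟨t', ht'⟩ := ih (g := fun m => g (m + 1)) (fun m => hg _) (fun m => hg0 _)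
      (fun m => hg1 _) (q := fun n => q (n + 1)) (fun a b h => hq (Nat.succ_le_succ h))
      (fun n => hq1 _)
    -- `t'` settles all tails starting at index 1 or later; prepending `s` leaves them unchanged, so
    -- only the total union remains to be adjusted, by varying `s` from 0 (where `{g 0 < s}` is
    -- empty) to 1 (where it is everything).
    let t : ℝ → ℕ → ℝ := fun s m => Nat.casesOn m s fun m => (t' m : ℝ)
    have htc : Continuous t := continuous_pi fun m => by
      cases m with
      | zero => exact continuous_id
      | succ m => exact continuous_const
    have hshift : ∀ s n, sublevelUnion g (t s) (n + 1) (N + 1) =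
        sublevelUnion (fun m => g (m + 1)) (fun m => t' m) n N := fun s n => by
      ext ω
      constructor
      · rintro ⟨_ | m, h1, h2, h3⟩
        · omega
        · exact ⟨m, by omega, by omega, h3⟩
      · rintro ⟨m, h1, h2, h3⟩
        exact ⟨m + 1, by omega, by omega, h3⟩
    have hcont : Continuous fun s => μ.real (sublevelUnion g (t s) 0 (N + 1)) :=
      (continuous_measureReal_sublevelUnion μ hg hg0 0 (N + 1)).comp htc
    have h0 : μ.real (sublevelUnion g (t 0) 0 (N + 1)) = q 1 - q (N + 1) := by
      rw [← ht' 0 (Nat.zero_le _), ← hshift 0]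
      congr 1
      ext ω
      constructor
      · rintro ⟨_ | m, h1, h2, h3⟩
        · exact absurd h3 (hg1 0 ω).1.le.not_gt
        · exact ⟨m + 1, by omega, h2, h3⟩
      · rintro ⟨m, h1, h2, h3⟩
        exact ⟨m, by omega, h2, h3⟩
    have h1 : μ.real (sublevelUnion g (t 1) 0 (N + 1)) = 1 := by
      have : sublevelUnion g (t 1) 0 (N + 1) = Set.univ :=
        Set.eq_univ_of_forall fun ω => ⟨0, le_rfl, Nat.succ_pos _, (hg1 0 ω).2⟩
      rw [this, probReal_univ]
    obtain ⟨s, hs, hsq⟩ : q 0 - q (N + 1) ∈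
        (fun s => μ.real (sublevelUnion g (t s) 0 (N + 1))) '' Set.Icc 0 1 := by
      refine intermediate_value_Icc zero_le_one hcont.continuousOn ⟨?_, ?_⟩
      · simp only [h0]
        have := hq (Nat.zero_le 1)
        linarith
      · simp only [h1]
        have := (hq1 0).2
        have := (hq1 (N + 1)).1
        linarith
    have hst : ∀ m, t s m ∈ Set.Icc (0 : ℝ) 1 := by
      rintro (_ | m)
      · exact hs
      · exact (t' m).2
    refine ⟨fun m => ⟨t s m, hst m⟩, ?_⟩
    rintro (_ | n) hn
    · exact hsq
    · change μ.real (sublevelUnion g (t s) (n + 1) (N + 1)) = _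
      rw [hshift]
      exact ht' n (Nat.succ_le_succ_iff.1 hn)

/-- Thresholds can be chosen such that all tail unions of sublevel sets of atomless observables have
prescribed measure. -/
theorem exists_measureReal_iUnion_sublevelUnion_eq {Ω : Type*} [MeasurableSpace Ω] (μ : Measure Ω)
    [IsProbabilityMeasure μ] {g : ℕ → Ω → ℝ} (hg : ∀ m, Measurable (g m))
    (hg0 : ∀ m a, μ (g m ⁻¹' {a}) = 0) (hg1 : ∀ m ω, g m ω ∈ Set.Ioo 0 1)
    {q : ℕ → ℝ} (hq : Antitone q) (hq1 : ∀ n, q n ∈ Set.Icc 0 1)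
    (hq0 : Tendsto q atTop (𝓝 0)) :
    ∃ t : ℕ → ℝ, ∀ n, μ.real (⋃ N, sublevelUnion g t n N) = q n := by
  choose t ht using fun N => exists_measureReal_sublevelUnion_eq μ N hg hg0 hg1 hq hq1
  obtain ⟨a, φ, hφ, ha⟩ := CompactSpace.tendsto_subseq t
  refine ⟨fun m => a m, fun n => ?_⟩
  have ha' : Tendsto (fun k m => (t (φ k) m : ℝ)) atTop (𝓝 fun m => (a m : ℝ)) := by
    rw [tendsto_pi_nhds] at ha ⊢
    exact fun m => (continuous_subtype_val.tendsto _).comp (ha m)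
  have hlim : ∀ M, Tendsto (fun k => μ.real (sublevelUnion g (fun m => t (φ k) m) n M)) atTop
      (𝓝 (μ.real (sublevelUnion g (fun m => a m) n M))) := fun M =>
    ((continuous_measureReal_sublevelUnion μ hg hg0 n M).tendsto _).comp ha'
  -- Truncating at `M` loses at most the tail from `M` to `φ k`, of measure `q M - q (φ k) ≤ q M`.
  -- The bound is uniform in `k`, so it survives the limit along the subsequence, and then `M` tends
  -- to infinity.
  have hbound : ∀ M, n ≤ M → ∀ k, M ≤ φ k →
      μ.real (sublevelUnion g (fun m => t (φ k) m) n M) ∈ Set.Icc (q n - q M) (q n) := by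
    intro M hnM k hk
    have h1 := ht (φ k) n (hnM.trans hk)
    have h2 := ht (φ k) M hk
    have h3 := measureReal_mono (μ := μ)
      (sublevelUnion_subset_union g (fun m => (t (φ k) m : ℝ)) n M (φ k))
    have h4 := measureReal_union_le (μ := μ) (sublevelUnion g (fun m => (t (φ k) m : ℝ)) n M)
      (sublevelUnion g (fun m => (t (φ k) m : ℝ)) M (φ k))
    have h5 := measureReal_mono (μ := μ) (sublevelUnion_mono g (fun m => (t (φ k) m : ℝ)) n hk)
    have h6 := (hq1 (φ k)).1
    constructor <;> linarith
  have hmem : ∀ M, n ≤ M →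
      μ.real (sublevelUnion g (fun m => a m) n M) ∈ Set.Icc (q n - q M) (q n) := fun M hnM =>
    isClosed_Icc.mem_of_tendsto (hlim M)
      ((hφ.tendsto_atTop.eventually_ge_atTop M).mono fun k hk => hbound M hnM k hk)
  have hU : Tendsto (fun M => μ.real (sublevelUnion g (fun m => a m) n M)) atTop
      (𝓝 (μ.real (⋃ N, sublevelUnion g (fun m => a m) n N))) :=
    (ENNReal.tendsto_toReal (measure_ne_top _ _)).comp
      (tendsto_measure_iUnion_atTop (sublevelUnion_mono g _ n))
  refine tendsto_nhds_unique hU ?_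
  refine tendsto_of_tendsto_of_tendsto_of_le_of_le' (g := fun M => q n - q M) (h := fun _ => q n)
    ?_ tendsto_const_nhds ?_ ?_
  · simpa using hq0.const_sub (q n)
  · exact (eventually_ge_atTop n).mono fun M hM => (hmem M hM).1
  · exact (eventually_ge_atTop n).mono fun M hM => (hmem M hM).2

/-! ### Labellings with prescribed law and rare transitions. -/

/-- Almost invariant countable partitions with prescribed distribution: the rate of the transitions
between distinct cells with larger index `k` is at most `δ k`. -/
theorem Ergodic.exists_measurable_nat_map_eq {Ω : Type*} [MeasurableSpace Ω]
    {μ : Measure Ω} [IsProbabilityMeasure μ] {T : Ω → Ω} (hT : Ergodic T μ) {u : Ω → ℝ}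
    (hu : Measurable u) (hu0 : ∀ a, μ (u ⁻¹' {a}) = 0) (ρ : Measure ℕ) [IsProbabilityMeasure ρ]
    {δ : ℕ → ENNReal} (hδ : ∀ k, δ k ≠ 0) :
    ∃ J : Ω → ℕ, Measurable J ∧ μ.map J = ρ ∧
      ∀ k, μ {ω | J ω ≠ J (T ω) ∧ max (J ω) (J (T ω)) = k} ≤ δ k := by
  choose g' hg' hg'0 hg'T using fun k => hT.exists_measurable_measure_ne_le hu hu0 (hδ k)
  -- The injective sigmoid moves the values into `(0, 1)` while keeping null fibres and invariance.
  set g : ℕ → Ω → ℝ := fun k ω => Real.sigmoid (g' k ω) with hgdef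
  have hg : ∀ m, Measurable (g m) := fun m => continuous_sigmoid.measurable.comp (hg' m)
  have hg0 : ∀ m a, μ (g m ⁻¹' {a}) = 0 := fun m a => by
    rcases Set.eq_empty_or_nonempty (g m ⁻¹' {a}) with h | ⟨ω₀, h₀⟩
    · rw [h, measure_empty]
    · refine measure_mono_null (fun ω hω => ?_) (hg'0 m (g' m ω₀))
      exact Real.sigmoid_injective ((hω : g m ω = a).trans (h₀ : g m ω₀ = a).symm)
  have hg1 : ∀ m ω, g m ω ∈ Set.Ioo 0 1 := fun m ω =>
    ⟨Real.sigmoid_pos _, Real.sigmoid_lt_one _⟩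
  have hq : Antitone fun n => ρ.real (Set.Ici n) := fun a b h =>
    measureReal_mono (Set.Ici_subset_Ici.2 h)
  have hq0 : Tendsto (fun n => ρ.real (Set.Ici n)) atTop (𝓝 0) := by
    have h := tendsto_measure_iInter_atTop (μ := ρ) (s := fun n : ℕ => Set.Ici n)
      (fun n => (MeasurableSet.of_discrete).nullMeasurableSet)
      (fun a b h => Set.Ici_subset_Ici.2 h) ⟨0, measure_ne_top _ _⟩
    have he : ⋂ n : ℕ, Set.Ici n = ∅ :=
      Set.eq_empty_of_forall_notMem fun x hx => by
        have := Set.mem_iInter.1 hx (x + 1)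
        simp at this
    rw [he, measure_empty] at h
    exact (ENNReal.tendsto_toReal ENNReal.zero_ne_top).comp h
  obtain ⟨t, ht⟩ := exists_measureReal_iUnion_sublevelUnion_eq μ hg hg0 hg1 hq
    (fun n => ⟨measureReal_nonneg, measureReal_le_one⟩) hq0
  set G : ℕ → Set Ω := fun n => ⋃ N, sublevelUnion g t n N with hG
  have hGm : ∀ n, MeasurableSet (G n) := fun n =>
    .iUnion fun N => measurableSet_sublevelUnion hg t n N
  have hmemG : ∀ n ω, ω ∈ G n ↔ ∃ m, n ≤ m ∧ g m ω < t m := fun n ω => by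
    simp only [hG, Set.mem_iUnion]
    constructor
    · rintro ⟨N, m, h1, -, h3⟩
      exact ⟨m, h1, h3⟩
    · rintro ⟨m, h1, h3⟩
      exact ⟨m + 1, m, h1, Nat.lt_succ_self m, h3⟩
  have hS0 : μ (⋂ n, G n) = 0 := by
    have h : μ.real (⋂ n, G n) ≤ 0 := ge_of_tendsto' hq0 fun n => by
      rw [← ht n]
      exact measureReal_mono (Set.iInter_subset _ n)
    exact (measureReal_eq_zero_iff).1 (le_antisymm h measureReal_nonneg)
  have hS : ∀ᵐ ω ∂μ, ∃ n, ω ∉ G n := by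
    have := measure_eq_zero_iff_ae_notMem.1 hS0
    simpa using this
  have hG0 : ∀ᵐ ω ∂μ, ω ∈ G 0 := by
    have h : μ.real (G 0) = 1 := by
      rw [ht 0]
      have : Set.Ici (0 : ℕ) = Set.univ := by ext; simp
      rw [this, probReal_univ]
    exact (mem_ae_iff_prob_eq_one (hGm 0)).2 ((ENNReal.toReal_eq_one_iff _).1 h)
  -- The largest index below threshold; on the null set where the index set is empty or unbounded,
  -- `sSup` is 0.
  set J : Ω → ℕ := fun ω => sSup {m | g m ω < t m} with hJ
  have hbdd : ∀ ω, (∃ n, ω ∉ G n) → BddAbove {m | g m ω < t m} := fun ω ⟨n, hn⟩ =>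
    ⟨n, fun m hm => by
      by_contra h
      exact hn ((hmemG n ω).2 ⟨m, (not_le.1 h).le, hm⟩)⟩
  have hJmem : ∀ ω, ω ∈ G 0 → (∃ n, ω ∉ G n) → g (J ω) ω < t (J ω) := fun ω h0 h => by
    obtain ⟨m, -, hm⟩ := (hmemG 0 ω).1 h0
    exact Nat.sSup_mem ⟨m, hm⟩ (hbdd ω h)
  have hJle : ∀ ω m, (∃ n, ω ∉ G n) → g m ω < t m → m ≤ J ω := fun ω m h hm =>
    le_csSup (hbdd ω h) hm
  -- A label at least `n + 1` cannot be the default 0, so this identity holds exactly and not just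
  -- almost everywhere.
  have hJsucc : ∀ n, J ⁻¹' Set.Ici (n + 1) = G (n + 1) \ ⋂ n, G n := fun n => by
    ext ω
    simp only [Set.mem_preimage, Set.mem_Ici, Set.mem_sdiff, Set.mem_iInter, not_forall]
    constructor
    · intro h
      have hb : BddAbove {m | g m ω < t m} := by
        by_contra hb
        have : J ω = 0 := by simp only [hJ]; exact Nat.sSup_of_not_bddAbove hb
        omega
      have hne : {m | g m ω < t m}.Nonempty := by
        by_contra hne
        have : J ω = 0 := by
          simp only [hJ]; rw [Set.not_nonempty_iff_eq_empty.1 hne]; simp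
        omega
      refine ⟨(hmemG _ ω).2 ⟨J ω, h, Nat.sSup_mem hne hb⟩, ?_⟩
      obtain ⟨b, hb⟩ := hb
      refine ⟨b + 1, fun hG => ?_⟩
      obtain ⟨m, h1, h2⟩ := (hmemG _ ω).1 hG
      have := hb h2
      omega
    · rintro ⟨h, h'⟩
      obtain ⟨m, h1, h2⟩ := (hmemG _ ω).1 h
      exact h1.trans (hJle ω m h' h2)
  have hJm : Measurable J := by
    refine measurable_of_Ici fun n => ?_
    cases n with
    | zero =>
      have : Set.Ici (0 : ℕ) = Set.univ := by ext; simp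
      rw [this]; exact MeasurableSet.univ
    | succ n => rw [hJsucc]; exact (hGm _).diff (.iInter hGm)
  have : IsProbabilityMeasure (μ.map J) := Measure.isProbabilityMeasure_map hJm.aemeasurable
  refine ⟨J, hJm, Measure.ext_of_Ici _ _ fun n => ?_, fun k => ?_⟩
  · cases n with
    | zero =>
      have : Set.Ici (0 : ℕ) = Set.univ := by ext; simp
      rw [this, measure_univ, measure_univ]
    | succ n =>
      rw [Measure.map_apply hJm measurableSet_Ici, hJsucc, measure_sdiff_null hS0]
      exact (ENNReal.toReal_eq_toReal_iff' (measure_ne_top _ _) (measure_ne_top _ _)).1 (ht (n + 1))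
  · refine le_trans (measure_mono_ae ?_) (hg'T k)
    have hq := hT.quasiMeasurePreserving
    filter_upwards [hG0, hS, hq.ae hG0, hq.ae hS] with ω h1 h2 h3 h4 hω
    obtain ⟨hne, hmax⟩ := hω
    intro heq
    have hgk : g k (T ω) = g k ω := congrArg Real.sigmoid heq
    -- Since `g k` agrees at `ω` and `T ω` and is below `t k` at the one with label `k`, it is below
    -- at the other, whose label is then at least `k`.
    rcases lt_or_gt_of_ne hne with h | h
    · rw [max_eq_right h.le] at hmax
      have := hJle ω k h2 (by rw [← hgk, ← hmax]; exact hJmem _ h3 h4)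
      omega
    · rw [max_eq_left h.le] at hmax
      have := hJle (T ω) k h4 (by rw [hgk, ← hmax]; exact hJmem _ h1 h2)
      omega

/-! ### Cells of small cost, and lifting labels to points. -/

/-- Off a null set, a Polish probability space splits into countably many cells of small cost such
that the cost between any two cells is bounded. -/
theorem IsCostFunction.exists_measurable_nat {X : Type*} [TopologicalSpace X] [PolishSpace X]
    [MeasurableSpace X] [BorelSpace X] (η : Measure X) [IsFiniteMeasure η] {c : X × X → ℝ}
    (hc : IsCostFunction c) {ε : ℝ} (hε : 0 < ε) :
    ∃ (J : X → ℕ) (C : ℕ → ℝ) (S : Set X), Measurable J ∧ (∀ᵐ x ∂η, x ∈ S) ∧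
      (∀ x ∈ S, ∀ y ∈ S, J x = J y → c (x, y) ≤ ε) ∧
      ∀ x ∈ S, ∀ y ∈ S, c (x, y) ≤ C (max (J x) (J y)) := by
  classical
  -- Tightness supplies compact sets exhausting `η`; an upper semicontinuous cost is bounded above
  -- on products of compact sets.
  obtain ⟨K, hK, hKη⟩ : ∃ K : ℕ → Set X, (∀ n, IsCompact (K n)) ∧ ∀ᵐ x ∂η, ∃ n, x ∈ K n := by
    have h := (isTightMeasureSet_iff_exists_isCompact_measure_compl_le.1
      (isTightMeasureSet_singleton (μ := η)))
    choose K hK hKη using fun n : ℕ => h ((n : ENNReal) + 1)⁻¹ (by simp)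
    refine ⟨K, hK, ?_⟩
    have h0 : η (⋂ n, (K n)ᶜ) = 0 := by
      refine le_antisymm (ge_of_tendsto' (f := fun n : ℕ => ((n : ENNReal) + 1)⁻¹) (x := atTop)
        ?_ fun n => (measure_mono (Set.iInter_subset _ n)).trans (hKη n η rfl)) (zero_le)
      have := (tendsto_add_atTop_iff_nat 1).2 ENNReal.tendsto_inv_nat_nhds_zero
      simpa using this
    have := measure_eq_zero_iff_ae_notMem.1 h0
    simpa using this
  have hU : ∀ x, ∃ U : Set X, IsOpen U ∧ x ∈ U ∧ ∀ y ∈ U, ∀ z ∈ U, c (y, z) < ε := fun x => by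
    have h : ∀ᶠ p in 𝓝 (x, x), c p < ε :=
      hc.upperSemicontinuous (x, x) ε ((hc.diag x).trans_lt hε)
    rw [nhds_prod_eq, eventually_prod_self_iff'] at h
    obtain ⟨V, hV, hVc⟩ := h
    obtain ⟨U, hUV, hUo, hxU⟩ := mem_nhds_iff.1 hV
    exact ⟨U, hUo, hxU, fun y hy z hz => hVc y (hUV hy) z (hUV hz)⟩
  choose U hUo hxU hUc using hU
  obtain ⟨D, hD, hDU⟩ := TopologicalSpace.countable_cover_nhds fun x => (hUo x).mem_nhds (hxU x)
  have hX : D = ∅ ∨ D.Nonempty := Set.eq_empty_or_nonempty D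
  rcases hX with rfl | hne
  · have hX : ∀ x : X, False := fun x => by
      have : x ∈ (∅ : Set X) := by simpa using hDU.ge (Set.mem_univ x)
      exact this
    exact ⟨fun _ => 0, fun _ => 0, ∅, measurable_const, ae_of_all _ fun x => (hX x).elim,
      fun x => (hX x).elim, fun x => (hX x).elim⟩
  obtain ⟨d, rfl⟩ := hD.exists_eq_range hne
  let V : ℕ → Set X := fun k => K k.unpair.1 ∩ U (d k.unpair.2)
  have hVm : ∀ k, MeasurableSet (V k) := fun k => (hK _).measurableSet.inter (hUo _).measurableSet
  let S : Set X := ⋃ k, V k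
  have hSm : MeasurableSet S := .iUnion hVm
  have hS : ∀ᵐ x ∂η, x ∈ S := by
    filter_upwards [hKη] with x ⟨n, hn⟩
    have hx : x ∈ ⋃ y ∈ Set.range d, U y := hDU.symm ▸ Set.mem_univ x
    simp only [Set.mem_range, Set.iUnion_exists, Set.iUnion_iUnion_eq', Set.mem_iUnion] at hx
    obtain ⟨j, hj⟩ := hx
    exact Set.mem_iUnion.2 ⟨Nat.pair n j, by simpa [V] using ⟨hn, hj⟩⟩
  let p : X → ℕ → Prop := fun x k => x ∈ V k ∨ x ∉ S
  have hp : ∀ x, ∃ k, p x k := fun x => by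
    by_cases h : x ∈ S
    · exact (Set.mem_iUnion.1 h).imp fun k hk => Or.inl hk
    · exact ⟨0, Or.inr h⟩
  let J : X → ℕ := fun x => Nat.find (hp x)
  have hJm : Measurable J := measurable_find hp fun k => (hVm k).union hSm.compl
  have hJ : ∀ x ∈ S, x ∈ V (J x) := fun x hx =>
    (Nat.find_spec (hp x)).resolve_right (not_not_intro hx)
  have hbdd : ∀ i j, ∃ b, ∀ x ∈ V i, ∀ y ∈ V j, c (x, y) ≤ b := fun i j => by
    obtain ⟨b, hb⟩ := (hc.upperSemicontinuous.upperSemicontinuousOn _).bddAbove_of_isCompact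
      ((hK i.unpair.1).prod (hK j.unpair.1))
    exact ⟨b, fun x hx y hy => hb ⟨(x, y), ⟨hx.1, hy.1⟩, rfl⟩⟩
  choose b hb using hbdd
  -- Summing over all pairs of indices up to `k` dominates the bound of each such pair.
  refine ⟨J, fun k => ∑ i ∈ Finset.range (k + 1), ∑ j ∈ Finset.range (k + 1), |b i j|, S, hJm, hS,
    fun x hx y hy hxy => ?_, fun x hx y hy => ?_⟩
  · exact (hUc _ x (hJ x hx).2 y (hxy ▸ (hJ y hy).2)).le
  · calc c (x, y) ≤ |b (J x) (J y)| := (hb _ _ x (hJ x hx) y (hJ y hy)).trans (le_abs_self _)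
      _ ≤ ∑ j ∈ Finset.range (max (J x) (J y) + 1), |b (J x) j| :=
        Finset.single_le_sum (f := fun j => |b (J x) j|) (fun _ _ => abs_nonneg _)
          (Finset.mem_range.2 (Nat.lt_succ_of_le (le_max_right _ _)))
      _ ≤ _ := Finset.single_le_sum (f := fun i => ∑ j ∈ Finset.range _, |b i j|)
          (fun _ _ => Finset.sum_nonneg fun _ _ => abs_nonneg _)
          (Finset.mem_range.2 (Nat.lt_succ_of_le (le_max_left _ _)))

theorem measure_eq_tsum_inter_preimage_singleton {α : Type*} [MeasurableSpace α] (ν : Measure α)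
    {L : α → ℕ} (hL : Measurable L) {s : Set α} (hs : MeasurableSet s) :
    ν s = ∑' n, ν (s ∩ L ⁻¹' {n}) := by
  rw [← measure_iUnion]
  · congr 1
    ext x
    simp
  · intro i j hij
    refine Set.disjoint_left.2 ?_
    rintro x ⟨-, rfl⟩ ⟨-, h⟩
    exact hij h
  · exact fun n => hs.inter (hL (measurableSet_singleton n))

/-- A labelling of `Ω` with the law of a labelling of `X` lifts to a map with the law on `X`. -/
theorem exists_measurable_map_eq_of_map_nat_eq {Ω X : Type*} [MeasurableSpace Ω]
    [MeasurableSpace X] [StandardBorelSpace X] [Nonempty X] {μ : Measure Ω} [IsFiniteMeasure μ]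
    {η : Measure X} {u : Ω → ℝ} (hu : Measurable u)
    (hu0 : ∀ a, μ (u ⁻¹' {a}) = 0) {L : Ω → ℕ} (hL : Measurable L) {J : X → ℕ} (hJ : Measurable J)
    (hLJ : μ.map L = η.map J) :
    ∃ f : Ω → X, Measurable f ∧ μ.map f = η ∧ ∀ᵐ ω ∂μ, J (f ω) = L ω := by
  have hLm : ∀ n, MeasurableSet (L ⁻¹' {n}) := fun n => hL (measurableSet_singleton n)
  have hJm : ∀ n, MeasurableSet (J ⁻¹' {n}) := fun n => hJ (measurableSet_singleton n)
  -- Each label class is transported separately onto the cell of equal mass, and the pieces are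
  -- glued along `L`.
  have hf : ∀ n, ∃ f : Ω → X, Measurable f ∧
      (μ.restrict (L ⁻¹' {n})).map f = η.restrict (J ⁻¹' {n}) := fun n => by
    refine exists_measurable_map_eq_of_preimage_singleton _ _ ?_ hu fun a => ?_
    · rw [Measure.restrict_apply_univ, Measure.restrict_apply_univ,
        ← Measure.map_apply hL (measurableSet_singleton n), hLJ,
        Measure.map_apply hJ (measurableSet_singleton n)]
    · exact le_antisymm ((Measure.restrict_apply_le _ _).trans (hu0 a).le) (zero_le)
  choose f hf hfη using hf
  have hFm : Measurable fun ω => f (L ω) ω := by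
    have : Measurable fun x : Ω × ℕ => f x.2 x.1 := measurable_from_prod_countable_left hf
    exact this.comp (measurable_id.prodMk hL)
  have hinter : ∀ n {s : Set X}, MeasurableSet s →
      μ ((fun ω => f (L ω) ω) ⁻¹' s ∩ L ⁻¹' {n}) = η (s ∩ J ⁻¹' {n}) := fun n s hs => by
    rw [← Measure.restrict_apply hs, ← hfη n, Measure.map_apply (hf n) hs,
      Measure.restrict_apply (hf n hs)]
    congr 1
    ext ω
    constructor
    · rintro ⟨h1, rfl⟩
      exact ⟨h1, rfl⟩
    · rintro ⟨h1, rfl⟩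
      exact ⟨h1, rfl⟩
  refine ⟨_, hFm, ?_, ?_⟩
  · ext s hs
    rw [Measure.map_apply hFm hs, measure_eq_tsum_inter_preimage_singleton μ hL (hFm hs),
      measure_eq_tsum_inter_preimage_singleton η hJ hs]
    exact tsum_congr fun n => hinter n hs
  · have h : ∀ n, ∀ᵐ ω ∂μ, ω ∉ (fun ω => f (L ω) ω) ⁻¹' (J ⁻¹' {n})ᶜ ∩ L ⁻¹' {n} := fun n => by
      rw [← measure_eq_zero_iff_ae_notMem, hinter n (hJm n).compl, Set.compl_inter_self,
        measure_empty]
    filter_upwards [ae_all_iff.2 h] with ω hω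
    by_contra hne
    exact hω (L ω) ⟨hne, rfl⟩

/-! ### Assembling the estimate. -/

theorem theoremt {Ω : Type*} [MeasurableSpace Ω] (μ : Measure Ω) [IsProbabilityMeasure μ]
    (hμ : IsLebesgueSpace μ) [NullSingletonClass μ]
    (T : Ω ≃ᵐ Ω) (hT : Ergodic T μ)
    {X : Type*} [TopologicalSpace X] [PolishSpace X] [MeasurableSpace X] [BorelSpace X]
    (η : Measure X) [IsProbabilityMeasure η]
    (c : X × X → ℝ) (hc : IsCostFunction c)
    (ε : ℝ) (hε : 0 < ε) :
    ∃ f : Ω → X, Measurable f ∧ μ.map f = η ∧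
      Integrable (fun ω => c (f ω, f (T ω))) μ ∧
      ∫ ω, c (f ω, f (T ω)) ∂μ < ε := by
  obtain ⟨u, hu, hu0⟩ := hμ.exists_measurable_preimage_singleton
  obtain ⟨J, C, S, hJ, hS, hC, hC'⟩ := hc.exists_measurable_nat η (half_pos hε)
  have : Nonempty X := nonempty_of_isProbabilityMeasure η
  obtain ⟨d, hd0, hd⟩ := ENNReal.exists_pos_sum_of_countable'
    (ENNReal.ofReal_pos.2 (half_pos hε)).ne' ℕ
  have : IsProbabilityMeasure (η.map J) := Measure.isProbabilityMeasure_map hJ.aemeasurable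
  obtain ⟨L, hL, hLρ, hLT⟩ := hT.exists_measurable_nat_map_eq hu hu0 (η.map J)
    -- The `+ 1` keeps the denominator nonzero; transitions at level `k` then cost at most `d k`,
    -- and `∑ d k < ε / 2`.
    (δ := fun k => d k / (ENNReal.ofReal (C k) + 1)) fun k =>
      (ENNReal.div_pos (hd0 k).ne' (by finiteness)).ne'
  obtain ⟨f, hf, hfη, hfL⟩ := exists_measurable_map_eq_of_map_nat_eq hu hu0 hL hJ hLρ
  have hTq := hT.quasiMeasurePreserving
  have hfS : ∀ᵐ ω ∂μ, f ω ∈ S := ae_of_ae_map hf.aemeasurable (hfη.symm ▸ hS)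
  have hcm : Measurable fun ω => c (f ω, f (T ω)) :=
    hc.upperSemicontinuous.measurable.comp (hf.prodMk (hf.comp hT.measurable))
  let A : ℕ → Set Ω := fun k => {ω | L ω ≠ L (T ω) ∧ max (L ω) (L (T ω)) = k}
  have hA : ∀ k, MeasurableSet (A k) := fun k =>
    (measurableSet_eq_fun hL (hL.comp hT.measurable)).compl.inter
      ((hL.max (hL.comp hT.measurable)) (measurableSet_singleton k))
  have hlint : ∫⁻ ω, ENNReal.ofReal (c (f ω, f (T ω))) ∂μ < ENNReal.ofReal ε := by
    calc ∫⁻ ω, ENNReal.ofReal (c (f ω, f (T ω))) ∂μ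
        ≤ ∫⁻ ω, ENNReal.ofReal (ε / 2) +
            ∑' k, (A k).indicator (fun _ => ENNReal.ofReal (C k)) ω ∂μ := by
          refine lintegral_mono_ae ?_
          filter_upwards [hfS, hfL, hTq.ae hfS, hTq.ae hfL] with ω h1 h2 h3 h4
          by_cases h : L ω = L (T ω)
          · exact (ENNReal.ofReal_le_ofReal (hC _ h1 _ h3 (by rw [h2, h4, h]))).trans le_self_add
          · refine le_trans ?_ (le_add_self)
            refine le_trans ?_ (ENNReal.le_tsum (max (L ω) (L (T ω))))
            rw [Set.indicator_of_mem (show ω ∈ A _ from ⟨h, rfl⟩)]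
            have := hC' _ h1 _ h3
            rw [h2, h4] at this
            exact ENNReal.ofReal_le_ofReal this
      _ = ENNReal.ofReal (ε / 2) + ∑' k, ENNReal.ofReal (C k) * μ (A k) := by
          rw [lintegral_add_left measurable_const, lintegral_const, measure_univ, mul_one,
            lintegral_tsum fun k => (measurable_const.indicator (hA k)).aemeasurable]
          simp_rw [lintegral_indicator_const (hA _)]
      _ ≤ ENNReal.ofReal (ε / 2) + ∑' k, d k := by
          gcongr with k
          calc ENNReal.ofReal (C k) * μ (A k)
              ≤ (ENNReal.ofReal (C k) + 1) * (d k / (ENNReal.ofReal (C k) + 1)) :=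
                mul_le_mul' le_self_add (hLT k)
            _ ≤ d k := ENNReal.mul_div_le
      _ < ENNReal.ofReal (ε / 2) + ENNReal.ofReal (ε / 2) :=
          ENNReal.add_lt_add_left ENNReal.ofReal_ne_top hd
      _ = ENNReal.ofReal ε := by
          rw [← ENNReal.ofReal_add (half_pos hε).le (half_pos hε).le, add_halves]
  refine ⟨f, hf, hfη, ?_, ?_⟩
  · refine ⟨hcm.aestronglyMeasurable, ?_⟩
    rw [hasFiniteIntegral_iff_ofReal (ae_of_all _ fun ω => hc.nonneg _)]
    exact hlint.trans ENNReal.ofReal_lt_top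
  · rw [integral_eq_lintegral_of_nonneg_ae (ae_of_all _ fun ω => hc.nonneg _)
      hcm.aestronglyMeasurable]
    exact (ENNReal.lt_ofReal_iff_toReal_lt hlint.ne_top).1 hlint
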